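/- Let $M$ be a Riemann surface (not assumed compact), let $E\to M$ be a holomorphic vector bundle of finite rank, and let $h$ be a continuous Hermitian metric on $E$. Let $D=\sum_p m_p\cdot p$ be a divisor on $M$, i.e. a function $p\mapsto m_p\in\mathbb Z$ on $M$ whose support $\operatorname{supp}(D)=\{p : m_p\neq 0\}$ is locally finite. Let $\rho$ be a $D$-volume form on $M$, i.e. a positive continuous volume form on $M\setminus\operatorname{supp}(D)$ such that for every $p\in\operatorname{supp}(D)$ there are a holomorphic local coordinate $z$ centred at $p$ and a constant $c_p>0$ for which, writing $\rho=f\,\tfrac{i}{2}\,dz\wedge d\bar z$ near $p$, one has $f(z)/\bigl(c_p|z|^{2m_p}\bigr)\to 1$ as $z\to 0$, $z\ne0$. Let $$A^2(M,\rho,E,h)=\Bigl\{\,s\in H^0(M,E)\ \Big|\ \int_{M\setminus\operatorname{supp}(D)}h(s,s)\,\rho<\infty\Bigr\},$$ where $H^0(M,E)$ is the space of holomorphic sections of $E$ over $M$. Then $A^2(M,\rho,E,h)$ is a complex Hilbert space with respect to the $L^2$ scalar product: it is a linear subspace of $H^0(M,E)$; for all $s,t\in A^2(M,\rho,E,h)$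 the integral $$\langle s,t\rangle=\int_{M\setminus\operatorname{supp}(D)}h(s,t)\,\rho$$ converges absolutely; $\langle\cdot,\cdot\rangle$ is a positive definite Hermitian inner product; and $A^2(M,\rho,E,h)$ is complete in the associated norm. -/

import Mathlib

open Bundle MeasureTheory
open scoped Manifold ContDiff Topology

noncomputable section

namespace Bergman

section VolumeForms

variable {M : Type*} [TopologicalSpace M] [ChartedSpace ℂ M]

/-- A (not necessarily continuous) real `2`-form on the underlying real surface of `M`. -/
abbrev TwoForm (M : Type*) [TopologicalSpace M] [ChartedSpace ℂ M] : Type _ :=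
  ∀ x : M, (TangentSpace 𝓘(ℂ, ℂ) x) [⋀^Fin 2]→ₗ[ℝ] ℝ

/-- The coefficient `f` of `ρ = f dx ∧ dy = f (i/2) dz ∧ dz̄` in the local coordinate
`z = x + i y` given by `φ`: the value of `ρ` on the coordinate vector fields `∂/∂x`, `∂/∂y`,
as a function on `φ.target`. -/
def TwoForm.coeff (ρ : TwoForm M) (φ : OpenPartialHomeomorph M ℂ) (z : ℂ) : ℝ :=
  ρ (φ.symm z) ![mfderiv 𝓘(ℂ, ℂ) 𝓘(ℂ, ℂ) φ.symm z (1 : ℂ),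
    mfderiv 𝓘(ℂ, ℂ) 𝓘(ℂ, ℂ) φ.symm z Complex.I]

/-- `ρ` is a positive continuous volume form on `M \ S`. The values of `ρ` on `S` are arbitrary
and are never used. -/
structure IsVolumeFormOff (ρ : TwoForm M) (S : Set M) : Prop where
  continuousOn : ∀ φ ∈ IsManifold.maximalAtlas 𝓘(ℂ, ℂ) ω M,
    ContinuousOn (ρ.coeff φ) (φ.target \ φ.symm ⁻¹' S)
  pos : ∀ φ ∈ IsManifold.maximalAtlas 𝓘(ℂ, ℂ) ω M,
    ∀ z ∈ φ.target \ φ.symm ⁻¹' S, 0 < ρ.coeff φ z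

/-- The Borel measure on `M` given by integrating `ρ` over `M \ S`. It is glued from the measures
`f dx dy` in the local coordinates, as the least measure that dominates all of them. -/
def TwoForm.measureOff [MeasurableSpace M] (ρ : TwoForm M) (S : Set M) : Measure M :=
  ⨆ φ ∈ IsManifold.maximalAtlas 𝓘(ℂ, ℂ) ω M,
    (((volume : Measure ℂ).restrict (φ.target \ φ.symm ⁻¹' S)).withDensity
      fun z => ENNReal.ofReal (ρ.coeff φ z)).map φ.symm

/-- A divisor on `M`: an integer-valued function with locally finite support. -/
abbrev Divisor (M : Type*) [TopologicalSpace M] : Type _ := Function.locallyFinsupp M ℤ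

/-- `ρ` is a `D`-volume form on `M`. -/
structure IsDivisorVolumeForm (D : Divisor M) (ρ : TwoForm M) : Prop
    extends IsVolumeFormOff ρ D.support where
  asymptotic : ∀ p ∈ D.support, ∃ φ ∈ IsManifold.maximalAtlas 𝓘(ℂ, ℂ) ω M,
    p ∈ φ.source ∧ φ p = 0 ∧ ∃ c : ℝ, 0 < c ∧
      Asymptotics.IsEquivalent (𝓝[≠] (0 : ℂ)) (ρ.coeff φ) (fun z => c * ‖z‖ ^ (2 * D p))

end VolumeForms

section HermitianBundles

variable {M : Type*} [TopologicalSpace M] [ChartedSpace ℂ M]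
  {F : Type*} [NormedAddCommGroup F] [NormedSpace ℂ F]
  {E : M → Type*} [TopologicalSpace (TotalSpace F E)] [∀ x, AddCommGroup (E x)]
  [∀ x, Module ℂ (E x)] [∀ x, TopologicalSpace (E x)] [FiberBundle F E] [VectorBundle ℂ F E]

variable (F E) in
/-- A continuous Hermitian metric on the vector bundle `E`: a Hermitian inner product on each
fibre (conjugate linear in the first variable), whose Gram matrices in the local trivializations
are continuous. -/
structure HermitianMetric where
  core : ∀ x, InnerProductSpace.Core ℂ (E x)
  continuousOn : ∀ (x₀ : M) (v w : F),
    ContinuousOn (fun x => (core x).inner ((trivializationAt F E x₀).symm x v)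
      ((trivializationAt F E x₀).symm x w)) (trivializationAt F E x₀).baseSet

/-- The value `h(v, w)` for `v`, `w` in the fibre over `x`. -/
def HermitianMetric.inner (h : HermitianMetric F E) {x : M} (v w : E x) : ℂ :=
  (h.core x).inner v w

/-- The space `H⁰(M, E)` of holomorphic sections of `E`. -/
abbrev HolomorphicSection (F : Type*) [NormedAddCommGroup F] [NormedSpace ℂ F]
    (E : M → Type*) [TopologicalSpace (TotalSpace F E)] [∀ x, AddCommGroup (E x)]
    [∀ x, Module ℂ (E x)] [∀ x, TopologicalSpace (E x)] [FiberBundle F E]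
    [VectorBundle ℂ F E] : Type _ :=
  ContMDiffSection 𝓘(ℂ, ℂ) F ω E

variable [FiniteDimensional ℂ F]

theorem HermitianMetric.continuous_inner (h : HermitianMetric F E)
    (s t : HolomorphicSection F E) : Continuous fun x => h.inner (s x) (t x) := by
  rw [continuous_iff_continuousAt]
  intro x₀
  set e := trivializationAt F E x₀ with he
  let b := Module.finBasis ℂ F
  have hx₀ : x₀ ∈ e.baseSet := FiberBundle.mem_baseSet_trivializationAt' x₀
  have hcoord : ∀ u : HolomorphicSection F E, ∀ i,
      ContinuousAt (fun x => b.repr (e ⟨x, u x⟩).2 i) x₀ := by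
    intro u i
    have h1 : ContinuousAt (fun x => (e ⟨x, u x⟩).2) x₀ :=
      ((contMDiffAt_section (IB := 𝓘(ℂ, ℂ)) (s := fun x => u x) x₀).1 (u.contMDiff x₀)).continuousAt
    have h2 : Continuous fun v : F => b.repr v i :=
      LinearMap.continuous_of_finiteDimensional (b.coord i)
    exact h2.continuousAt.comp h1
  have key : ∀ x ∈ e.baseSet, h.inner (s x) (t x) =
      ∑ i, ∑ j, (starRingEnd ℂ) (b.repr (e ⟨x, s x⟩).2 i) * (b.repr (e ⟨x, t x⟩).2 j *
        (h.core x).inner (e.symm x (b i)) (e.symm x (b j))) := by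
    intro x hx
    have expand : ∀ u : HolomorphicSection F E,
        u x = ∑ i, b.repr (e ⟨x, u x⟩).2 i • e.symm x (b i) := by
      intro u
      have h1 : e.symm x (e ⟨x, u x⟩).2 = u x := e.symm_apply_apply_mk hx (u x)
      conv_lhs => rw [← h1, ← b.sum_repr (e ⟨x, u x⟩).2]
      have := map_sum (e.symmₗ ℂ x) (fun i => b.repr (e ⟨x, u x⟩).2 i • b i) Finset.univ
      simp only [map_smul] at this
      simpa only [Trivialization.coe_symmₗ _ hx] using this
    let _ := h.core x
    let _ : NormedAddCommGroup (E x) := (h.core x).toNormedAddCommGroup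
    let _ : InnerProductSpace ℂ (E x) := InnerProductSpace.ofCore (h.core x).toCore
    change Inner.inner ℂ (s x) (t x) = _
    conv_lhs => rw [expand s, expand t]
    simp only [sum_inner, inner_sum, inner_smul_left, inner_smul_right,
      Finset.mul_sum]
    rw [Finset.sum_comm]
    refine Finset.sum_congr rfl fun i _ => Finset.sum_congr rfl fun j _ => ?_
    exact mul_left_comm _ _ _
  have hcont : ContinuousAt (fun x => ∑ i, ∑ j, (starRingEnd ℂ) (b.repr (e ⟨x, s x⟩).2 i) *
      (b.repr (e ⟨x, t x⟩).2 j * (h.core x).inner (e.symm x (b i)) (e.symm x (b j)))) x₀ := by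
    refine tendsto_finsetSum _ fun i _ => tendsto_finsetSum _ fun j _ => ?_
    exact (Complex.continuous_conj.continuousAt.comp (hcoord s i)).mul ((hcoord t j).mul
      ((h.continuousOn x₀ (b i) (b j)).continuousAt (e.open_baseSet.mem_nhds hx₀)))
  refine hcont.congr ?_
  filter_upwards [e.open_baseSet.mem_nhds hx₀] with x hx using (key x hx).symm

variable [MeasurableSpace M] [BorelSpace M]

/-- The Bergman space `A²(M, ρ, E, h)`: the holomorphic sections `s` of `E` over `M` with
`∫_{M \ supp D} h(s, s) ρ < ∞`. -/
def bergmanSpace (D : Divisor M) (ρ : TwoForm M) (h : HermitianMetric F E) :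
    Submodule ℂ (HolomorphicSection F E) where
  carrier := {s | ∫⁻ x, ENNReal.ofReal (h.inner (s x) (s x)).re ∂(ρ.measureOff D.support) < ⊤}
  zero_mem' := by
    have h0 : ∀ x, h.inner (0 : E x) 0 = 0 := by
      intro x
      have := (h.core x).smul_left 0 0 0
      simpa [HermitianMetric.inner] using this
    simp [h0]
  add_mem' := by
    intro s t hs ht
    simp only [Set.mem_ofPred_eq] at hs ht ⊢
    have hle : ∀ x, (h.inner ((s + t) x) ((s + t) x)).re ≤
        2 * (h.inner (s x) (s x)).re + 2 * (h.inner (t x) (t x)).re := by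
      intro x
      let _ := h.core x
      let _ : NormedAddCommGroup (E x) := (h.core x).toNormedAddCommGroup
      let _ : InnerProductSpace ℂ (E x) := InnerProductSpace.ofCore (h.core x).toCore
      have e1 : ∀ v : E x, (h.inner v v).re = ‖v‖ ^ 2 := fun v =>
        (InnerProductSpace.norm_sq_eq_re_inner (𝕜 := ℂ) v).symm
      rw [e1, e1, e1]
      have h1 : ‖s x + t x‖ ≤ ‖s x‖ + ‖t x‖ := norm_add_le _ _
      have h2 : (s + t) x = s x + t x := rfl
      rw [h2]
      nlinarith [norm_nonneg (s x + t x), sq_nonneg (‖s x‖ - ‖t x‖)]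
    have hms : Measurable fun x => 2 * ENNReal.ofReal (h.inner (s x) (s x)).re :=
      ((Complex.continuous_re.comp (h.continuous_inner s s)).measurable.ennreal_ofReal).const_mul 2
    calc ∫⁻ x, ENNReal.ofReal (h.inner ((s + t) x) ((s + t) x)).re ∂(ρ.measureOff D.support)
        ≤ ∫⁻ x, (2 * ENNReal.ofReal (h.inner (s x) (s x)).re +
            2 * ENNReal.ofReal (h.inner (t x) (t x)).re) ∂(ρ.measureOff D.support) := by
          refine lintegral_mono fun x => ?_
          refine (ENNReal.ofReal_le_ofReal (hle x)).trans (ENNReal.ofReal_add_le.trans ?_)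
          rw [ENNReal.ofReal_mul (by norm_num), ENNReal.ofReal_mul (by norm_num)]
          simp
      _ < ⊤ := by
          rw [lintegral_add_left hms, lintegral_const_mul' _ _ (by simp),
            lintegral_const_mul' _ _ (by simp)]
          exact ENNReal.add_lt_top.2 ⟨ENNReal.mul_lt_top (by simp) hs,
            ENNReal.mul_lt_top (by simp) ht⟩
  smul_mem' := by
    intro c s hs
    simp only [Set.mem_ofPred_eq] at hs ⊢
    have hc : ∀ x, (h.inner ((c • s) x) ((c • s) x)).re = ‖c‖ ^ 2 * (h.inner (s x) (s x)).re := by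
      intro x
      let _ := h.core x
      let _ : NormedAddCommGroup (E x) := (h.core x).toNormedAddCommGroup
      let _ : InnerProductSpace ℂ (E x) := InnerProductSpace.ofCore (h.core x).toCore
      have e1 : ∀ v : E x, (h.inner v v).re = ‖v‖ ^ 2 := fun v =>
        (InnerProductSpace.norm_sq_eq_re_inner (𝕜 := ℂ) v).symm
      have h2 : (c • s) x = c • s x := rfl
      rw [e1, e1, h2, norm_smul, mul_pow]
    simp only [hc, ENNReal.ofReal_mul (sq_nonneg ‖c‖)]
    rw [lintegral_const_mul' _ _ (by simp)]
    exact ENNReal.mul_lt_top (by simp) hs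

/-- The `L²` scalar product `∫_{M \ supp D} h(s, t) ρ`. -/
def l2Inner (D : Divisor M) (ρ : TwoForm M) (h : HermitianMetric F E)
    (s t : HolomorphicSection F E) : ℂ :=
  ∫ x, h.inner (s x) (t x) ∂(ρ.measureOff D.support)

end HermitianBundles

end Bergman

end

/-! Away from the divisor, ρ has a positive continuous density in every coordinate. At a point of
supp D this density may vanish or blow up, so the L² norm does not directly control a section there.
Holomorphy repairs this: by Cauchy's formula, the values near the centre of a disc are bounded by
the L² norm over a surrounding annulus. Since supp D is locally finite, the annulus can be chosen to
miss it, and by compactness both ρ and h are bounded below there. Hence near every point the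
coordinates of s satisfy sup |s|² ≤ C ∫ h(s, s) ρ (`exists_coord_bound`).

This estimate gives definiteness. It also makes an L²-Cauchy sequence locally uniformly Cauchy, so
it converges to a holomorphic section s (`exists_tendsto_section`). Fatou's lemma upgrades this to
convergence in L² (`exists_tendsto_l2NormSq`), and s = (s - u_N) + u_N lies in the space for large
N. Absolute convergence of the scalar product follows from |h(s, t)| ≤ h(s, s) + h(t, t). -/

namespace Bergman

/-! ### Cauchy estimates over an annulus in the plane -/

section SubMeanValue

open Complex Metric Set

variable {F : Type*} [NormedAddCommGroup F] [NormedSpace ℂ F] [CompleteSpace F]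

/-- Cauchy's estimate by the mean over a circle, for points well inside the circle. -/
theorem norm_le_integral_circleMap {c z : ℂ} {t : ℝ} (ht : 0 < t) {g : ℂ → F}
    (hg : DifferentiableOn ℂ g (closedBall c t)) (hz : ‖z - c‖ ≤ t / 2) :
    ‖g z‖ ≤ ∫ θ in (-Real.pi)..Real.pi, ‖g (circleMap c t θ)‖ := by
  have hzmem : z ∈ ball c t := by
    rw [mem_ball, dist_eq_norm]; linarith
  have hcont : Continuous fun θ => g (circleMap c t θ) :=
    hg.continuousOn.comp_continuous (continuous_circleMap c t)
      fun θ => circleMap_mem_closedBall c ht.le θ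
  have hdcl : DiffContOnCl ℂ g (ball c t) := by
    refine ⟨hg.mono ball_subset_closedBall, ?_⟩
    rw [closure_ball c ht.ne']
    exact hg.continuousOn
  have hcauchy := hdcl.two_pi_i_inv_smul_circleIntegral_sub_inv_smul hzmem
  have hnorm : ‖∮ w in C(c, t), (w - z)⁻¹ • g w‖ ≤
      ∫ θ in (0 : ℝ)..2 * Real.pi, 2 * ‖g (circleMap c t θ)‖ := by
    refine intervalIntegral.norm_integral_le_of_norm_le Real.two_pi_pos.le ?_
      ((continuous_const.mul hcont.norm).intervalIntegrable _ _)
    refine Filter.Eventually.of_forall fun θ _ => ?_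
    -- The circle stays at distance at least t / 2 from z, so the Cauchy kernel times the speed t of
    -- the parametrization is at most 2.
    have hdist : t / 2 ≤ ‖circleMap c t θ - z‖ := by
      have h1 : ‖circleMap c t θ - c‖ = t := by
        simp [circleMap, abs_of_pos ht]
      have h2 : ‖circleMap c t θ - c‖ ≤ ‖circleMap c t θ - z‖ + ‖z - c‖ := by
        simpa using norm_add_le (circleMap c t θ - z) (z - c)
      linarith
    rw [norm_smul, norm_smul, norm_inv, ← mul_assoc]
    gcongr
    rw [deriv_circleMap, norm_mul, norm_circleMap_zero, norm_I, mul_one, abs_of_pos ht,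
      ← div_eq_mul_inv, div_le_iff₀ (by linarith)]
    linarith
  have hper : Function.Periodic (fun θ => ‖g (circleMap c t θ)‖) (2 * Real.pi) := fun θ => by
    simp only [periodic_circleMap c t θ]
  -- The range (-π, π) is the one used by polar coordinates.
  have hshift : ∫ θ in (0 : ℝ)..2 * Real.pi, ‖g (circleMap c t θ)‖ =
      ∫ θ in (-Real.pi)..Real.pi, ‖g (circleMap c t θ)‖ := by
    have := hper.intervalIntegral_add_eq 0 (-Real.pi)
    rw [zero_add] at this
    rw [this]
    congr 1
    ring
  rw [intervalIntegral.integral_const_mul, hshift] at hnorm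
  set J := ∫ θ in (-Real.pi)..Real.pi, ‖g (circleMap c t θ)‖
  have hJ : 0 ≤ J := intervalIntegral.integral_nonneg (by linarith [Real.pi_pos])
    fun _ _ => norm_nonneg _
  rw [← hcauchy, norm_smul]
  have h2π : ‖(2 * (Real.pi : ℂ) * I)⁻¹‖ = (2 * Real.pi)⁻¹ := by
    simp [abs_of_pos Real.pi_pos]
  rw [h2π, inv_mul_le_iff₀ Real.two_pi_pos]
  -- The resulting constant is 2 / (2π), which is less than 1.
  nlinarith [Real.pi_gt_three]

/-- `L¹` bound of a holomorphic function near the centre of a disc by its integral over an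
annulus. -/
theorem enorm_le_lintegral_annulus {c z : ℂ} {R : ℝ} (hR : 0 < R) {g : ℂ → F}
    (hg : DifferentiableOn ℂ g (closedBall c R)) (hz : ‖z - c‖ ≤ R / 4) :
    ENNReal.ofReal (R / 2) * ENNReal.ofReal (R / 2) * ‖g z‖ₑ ≤
      ∫⁻ w in closedBall c R \ ball c (R / 2), ‖g w‖ₑ := by
  have hmeas : MeasurableSet (closedBall c R \ ball c (R / 2)) :=
    measurableSet_closedBall.diff measurableSet_ball
  -- Extension by zero makes the integral one over the whole plane, which can be translated by c and
  -- written in polar coordinates.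
  set G : ℂ → ENNReal := (closedBall c R \ ball c (R / 2)).indicator fun w => ‖g w‖ₑ with hG
  have hGm : Measurable G := by
    classical
    rw [hG, ← piecewise_eq_indicator]
    exact ((hg.continuousOn.mono sdiff_subset).enorm).measurable_piecewise
      continuousOn_const hmeas
  rw [← lintegral_indicator hmeas, ← lintegral_add_left_eq_self G c,
    ← Complex.lintegral_comp_polarCoord_symm]
  have hsymm : ∀ p : ℝ × ℝ, c + Complex.polarCoord.symm p = circleMap c p.1 p.2 := fun p => by
    rw [Complex.polarCoord_symm_apply, circleMap, Complex.exp_mul_I, Complex.ofReal_cos,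
      Complex.ofReal_sin]
  simp only [hsymm, smul_eq_mul]
  have hsub : Ioo (R / 2) R ×ˢ Ioo (-Real.pi) Real.pi ⊆ _root_.polarCoord.target := by
    rw [polarCoord_target]
    exact prod_mono (fun t ht => lt_trans (by linarith) ht.1) le_rfl
  refine le_trans ?_ (lintegral_mono_set hsub)
  rw [Measure.volume_eq_prod, ← Measure.prod_restrict, lintegral_prod]
  -- One factor R / 2 is the length of the range of radii, the other a lower bound for the Jacobian
  -- t. The circle estimate applies because R / 4 < t / 2.
  · calc ENNReal.ofReal (R / 2) * ENNReal.ofReal (R / 2) * ‖g z‖ₑ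
        = ∫⁻ _ in Ioo (R / 2) R, ENNReal.ofReal (R / 2) * ‖g z‖ₑ := by
          rw [setLIntegral_const, Real.volume_Ioo, show R - R / 2 = R / 2 by ring]
          ring
      _ ≤ _ := by
          refine setLIntegral_mono' measurableSet_Ioo fun t ht => ?_
          have ht0 : 0 < t := by linarith [ht.1]
          have hgt : DifferentiableOn ℂ g (closedBall c t) :=
            hg.mono (closedBall_subset_closedBall ht.2.le)
          have hcont : Continuous fun θ => ‖g (circleMap c t θ)‖ :=
            (hgt.continuousOn.comp_continuous (continuous_circleMap c t)
              fun θ => circleMap_mem_closedBall c ht0.le θ).norm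
          have key := norm_le_integral_circleMap ht0 hgt (z := z) (by linarith [ht.1])
          rw [intervalIntegral.integral_of_le (by linarith [Real.pi_pos]),
            integral_Ioc_eq_integral_Ioo] at key
          have hint : IntegrableOn (fun θ => ‖g (circleMap c t θ)‖) (Ioo (-Real.pi) Real.pi) :=
            (hcont.integrableOn_Icc).mono_set Ioo_subset_Icc_self
          rw [lintegral_const_mul' _ _ ENNReal.ofReal_ne_top]
          gcongr
          · exact ht.1.le
          · rw [← ofReal_norm]
            refine (ENNReal.ofReal_le_ofReal key).trans ?_
            rw [ofReal_integral_eq_lintegral_ofReal hint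
              (Filter.Eventually.of_forall fun _ => norm_nonneg _)]
            refine lintegral_mono fun θ => ?_
            have hmem : circleMap c t θ ∈ closedBall c R \ ball c (R / 2) := by
              refine ⟨closedBall_subset_closedBall ht.2.le
                (circleMap_mem_closedBall c ht0.le θ), ?_⟩
              rw [mem_ball, dist_eq_norm, not_lt]
              simpa [circleMap, abs_of_pos ht0] using ht.1.le
            rw [hG, indicator_of_mem hmem, ofReal_norm]
  · have hcm : Continuous fun p : ℝ × ℝ => circleMap c p.1 p.2 := by
      unfold circleMap
      fun_prop
    exact (measurable_fst.ennreal_ofReal.mul (hGm.comp hcm.measurable)).aemeasurable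

/-- `L²` bound of a holomorphic function near the centre of a disc by its `L²` norm over an
annulus. -/
theorem exists_enorm_sq_le_lintegral_annulus (F : Type*) [NormedAddCommGroup F] [NormedSpace ℂ F]
    [CompleteSpace F] (c : ℂ) {R : ℝ} (hR : 0 < R) :
    ∃ C : ENNReal, C ≠ ⊤ ∧ ∀ g : ℂ → F, DifferentiableOn ℂ g (closedBall c R) →
      ∀ z, ‖z - c‖ ≤ R / 4 →
        ‖g z‖ₑ ^ 2 ≤ C * ∫⁻ w in closedBall c R \ ball c (R / 2), ‖g w‖ₑ ^ 2 := by
  set A := closedBall c R \ ball c (R / 2)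
  set a := ENNReal.ofReal (R / 2) * ENNReal.ofReal (R / 2) with ha
  have ha0 : a ≠ 0 := by simp [a, hR]
  have hat : a ≠ ⊤ := ENNReal.mul_ne_top ENNReal.ofReal_ne_top ENNReal.ofReal_ne_top
  clear_value a
  have hA : volume A ≠ ⊤ :=
    ((measure_mono sdiff_subset).trans_lt measure_closedBall_lt_top).ne
  have hmeas : MeasurableSet A := measurableSet_closedBall.diff measurableSet_ball
  refine ⟨(a ^ 2)⁻¹ * volume A, ENNReal.mul_ne_top (by simp [ha0]) hA, fun g hg z hz => ?_⟩
  have h1 := enorm_le_lintegral_annulus hR hg hz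
  have hae : AEMeasurable (fun w => ‖g w‖ₑ) (volume.restrict A) :=
    ((hg.continuousOn.mono sdiff_subset).enorm).aemeasurable hmeas
  -- Cauchy–Schwarz against the constant 1 turns the L¹ bound into an L² bound, at the cost of the
  -- area of A.
  have h2 := ENNReal.lintegral_mul_le_Lp_mul_Lq (volume.restrict A)
    Real.HolderConjugate.two_two hae (aemeasurable_const (b := 1))
  simp only [Pi.mul_apply, mul_one, lintegral_const,
    Measure.restrict_apply MeasurableSet.univ, univ_inter, ENNReal.rpow_ofNat,
    one_pow, one_mul] at h2
  rw [← ha] at h1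
  have h3 := pow_le_pow_left₀ zero_le (h1.trans h2) 2
  have hsq : ∀ x : ENNReal, (x ^ (1 / 2 : ℝ)) ^ 2 = x := fun x => by
    rw [← ENNReal.rpow_natCast, ← ENNReal.rpow_mul]; norm_num
  rw [mul_pow, mul_pow, hsq, hsq] at h3
  rw [mul_assoc, ← ENNReal.div_eq_inv_mul, ENNReal.le_div_iff_mul_le (by simp [ha0])
    (by simp [hat]), mul_comm, mul_comm (volume A)]
  exact h3

end SubMeanValue

/-! ### Local comparison of the metric, the volume form and the coordinates -/

section LocalEstimate

open Metric Set

variable {M : Type*} [TopologicalSpace M]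
  {F : Type*} [NormedAddCommGroup F]
  {E : M → Type*} [TopologicalSpace (TotalSpace F E)] [∀ x, AddCommGroup (E x)]
  [∀ x, Module ℂ (E x)] [∀ x, TopologicalSpace (E x)] [FiberBundle F E]

theorem HermitianMetric.inner_self_nonneg (h : HermitianMetric F E) {x : M} (v : E x) :
    0 ≤ (h.inner v v).re :=
  (h.core x).re_inner_nonneg v

/-- Definiteness concerns the full complex value; its imaginary part vanishes by Hermitian symmetry.
-/
theorem HermitianMetric.inner_self_pos (h : HermitianMetric F E) {x : M} {v : E x} (hv : v ≠ 0) :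
    0 < (h.inner v v).re := by
  refine lt_of_le_of_ne (h.inner_self_nonneg v) fun h0 => hv ((h.core x).definite v ?_)
  have hconj := (h.core x).conj_inner_symm v v
  exact Complex.ext h0.symm (Complex.conj_eq_iff_im.1 hconj)

theorem HermitianMetric.inner_smul_self (h : HermitianMetric F E) {x : M} (c : ℂ) (v : E x) :
    (h.inner (c • v) (c • v)).re = ‖c‖ ^ 2 * (h.inner v v).re := by
  let _ : NormedAddCommGroup (E x) := (h.core x).toNormedAddCommGroup
  let _ : InnerProductSpace ℂ (E x) := InnerProductSpace.ofCore (h.core x).toCore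
  have e1 : ∀ v : E x, (h.inner v v).re = ‖v‖ ^ 2 := fun v =>
    (InnerProductSpace.norm_sq_eq_re_inner (𝕜 := ℂ) v).symm
  rw [e1, e1, norm_smul, mul_pow]

/-- A sum of squares suffices here: it dominates h(s, t) by two integrable functions. -/
theorem HermitianMetric.norm_inner_le (h : HermitianMetric F E) {x : M} (v w : E x) :
    ‖h.inner v w‖ ≤ (h.inner v v).re + (h.inner w w).re := by
  let _ : NormedAddCommGroup (E x) := (h.core x).toNormedAddCommGroup
  let _ : InnerProductSpace ℂ (E x) := InnerProductSpace.ofCore (h.core x).toCore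
  have e1 : ∀ v : E x, (h.inner v v).re = ‖v‖ ^ 2 := fun v =>
    (InnerProductSpace.norm_sq_eq_re_inner (𝕜 := ℂ) v).symm
  rw [e1, e1]
  have h1 : ‖h.inner v w‖ ≤ ‖v‖ * ‖w‖ := norm_inner_le_norm (𝕜 := ℂ) v w
  nlinarith [sq_nonneg (‖v‖ - ‖w‖), sq_nonneg ‖v‖, sq_nonneg ‖w‖]

variable [NormedSpace ℂ F] [VectorBundle ℂ F E]

section FiniteRank

variable [FiniteDimensional ℂ F]

/-- In a local trivialization, the square norm of a Hermitian metric is jointly continuous. -/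
theorem HermitianMetric.continuousOn_inner_symm (h : HermitianMetric F E) (x₀ : M) :
    ContinuousOn (fun p : M × F => (h.inner ((trivializationAt F E x₀).symm p.1 p.2)
      ((trivializationAt F E x₀).symm p.1 p.2)).re)
      ((trivializationAt F E x₀).baseSet ×ˢ univ) := by
  set e := trivializationAt F E x₀
  let b := Module.finBasis ℂ F
  -- The square norm is a sesquilinear expression in the coordinates whose coefficients are the
  -- continuous entries of the Gram matrix.
  have key : ∀ p ∈ e.baseSet ×ˢ (univ : Set F), h.inner (e.symm p.1 p.2) (e.symm p.1 p.2) =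
      ∑ i, ∑ j, (starRingEnd ℂ) (b.repr p.2 i) * (b.repr p.2 j *
        (h.core p.1).inner (e.symm p.1 (b i)) (e.symm p.1 (b j))) := by
    rintro ⟨x, v⟩ ⟨hx, -⟩
    have expand : e.symm x v = ∑ i, b.repr v i • e.symm x (b i) := by
      conv_lhs => rw [← b.sum_repr v]
      have := map_sum (e.symmₗ ℂ x) (fun i => b.repr v i • b i) Finset.univ
      simp only [map_smul] at this
      simpa only [Trivialization.coe_symmₗ _ hx] using this
    let _ : NormedAddCommGroup (E x) := (h.core x).toNormedAddCommGroup
    let _ : InnerProductSpace ℂ (E x) := InnerProductSpace.ofCore (h.core x).toCore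
    change Inner.inner ℂ (e.symm x v) (e.symm x v) = _
    conv_lhs => rw [expand]
    simp only [sum_inner, inner_sum, inner_smul_left, inner_smul_right, Finset.mul_sum]
    rw [Finset.sum_comm]
    refine Finset.sum_congr rfl fun i _ => Finset.sum_congr rfl fun j _ => ?_
    exact mul_left_comm _ _ _
  refine Complex.continuous_re.comp_continuousOn (ContinuousOn.congr ?_ key)
  refine continuousOn_finsetSum _ fun i _ => continuousOn_finsetSum _ fun j _ => ?_
  have hcoord : ∀ i, Continuous fun p : M × F => b.repr p.2 i := fun i =>
    (LinearMap.continuous_of_finiteDimensional (b.coord i)).comp continuous_snd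
  exact (Complex.continuous_conj.comp (hcoord i)).continuousOn.mul
    ((hcoord j).continuousOn.mul ((h.continuousOn x₀ (b i) (b j)).comp continuousOn_fst
      fun p hp => hp.1))

/-- Over a compact set, a Hermitian metric dominates the norm of the coordinates in a local
trivialization. -/
theorem HermitianMetric.exists_mul_norm_sq_le (h : HermitianMetric F E) (x₀ : M) {K : Set M}
    (hK : IsCompact K) (hKe : K ⊆ (trivializationAt F E x₀).baseSet) :
    ∃ ε : ℝ, 0 < ε ∧ ∀ x ∈ K, ∀ v : E x,
      ε * ‖(trivializationAt F E x₀ ⟨x, v⟩).2‖ ^ 2 ≤ (h.inner v v).re := by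
  set e := trivializationAt F E x₀
  have : ProperSpace F := FiniteDimensional.proper ℂ F
  -- A positive continuous function on the compact set K × (unit sphere) has a positive lower bound;
  -- homogeneity then handles all other vectors.
  obtain ⟨ε, hε, hle⟩ := (hK.prod (isCompact_sphere (0 : F) 1)).exists_forall_le'
    ((h.continuousOn_inner_symm x₀).mono (prod_mono hKe (subset_univ _))) (a := 0) (by
      rintro ⟨x, v⟩ ⟨hx, hv⟩
      refine h.inner_self_pos fun h0 => ?_
      have h1 : (e ⟨x, e.symm x v⟩).2 = v := by rw [e.apply_mk_symm (hKe hx)]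
      have h2 : (e ⟨x, (0 : E x)⟩).2 = 0 := congr_arg Prod.snd (e.zeroSection ℂ (hKe hx))
      rw [show e.symm x v = 0 from h0, h2] at h1
      simp [← h1] at hv)
  refine ⟨ε, hε, fun x hx v => ?_⟩
  set w := (e ⟨x, v⟩).2 with hw
  have hv : e.symm x w = v := e.symm_apply_apply_mk (hKe hx) v
  rcases eq_or_ne w 0 with h0 | h0
  · simpa [h0] using h.inner_self_nonneg v
  have hn : ‖w‖ ≠ 0 := norm_ne_zero_iff.2 h0
  set u : F := ((‖w‖⁻¹ : ℝ) : ℂ) • w with hu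
  have hu1 : u ∈ sphere (0 : F) 1 := by
    rw [mem_sphere_zero_iff_norm, hu, norm_smul, Complex.norm_real, norm_inv, norm_norm,
      inv_mul_cancel₀ hn]
  have hsu : e.symm x u = ((‖w‖⁻¹ : ℝ) : ℂ) • v := by
    have := map_smul (e.symmₗ ℂ x) ((‖w‖⁻¹ : ℝ) : ℂ) w
    rw [Trivialization.coe_symmₗ _ (hKe hx), hv] at this
    exact this
  have hle' := hle (x, u) ⟨hx, hu1⟩
  rw [show (trivializationAt F E x₀).symm x u = _ from hsu, h.inner_smul_self, Complex.norm_real,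
    norm_inv, norm_norm] at hle'
  rw [inv_pow, ← div_eq_inv_mul, le_div_iff₀ (by positivity)] at hle'
  exact hle'

/-- In a fibre, the square norm of a Hermitian metric is continuous. -/
theorem HermitianMetric.continuous_inner_self (h : HermitianMetric F E) (x : M) :
    Continuous fun v : E x => (h.inner v v).re := by
  set e := trivializationAt F E x
  have hx : x ∈ e.baseSet := FiberBundle.mem_baseSet_trivializationAt' x
  have h1 : Continuous fun w : F => (h.inner (e.symm x w) (e.symm x w)).re :=
    (h.continuousOn_inner_symm x).comp_continuous (f := fun w : F => (x, w))
      (by fun_prop) fun w => ⟨hx, mem_univ _⟩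
  have h2 := h1.comp (e.continuousLinearEquivAt ℂ x hx).continuous
  refine h2.congr fun v => ?_
  have h3 : e.symm x (e ⟨x, v⟩).2 = v := e.symm_apply_apply_mk hx v
  simp only [Function.comp_apply, Trivialization.continuousLinearEquivAt_apply, h3]

end FiniteRank

variable [ChartedSpace ℂ M]

/-- The coordinates of a holomorphic section are holomorphic. -/
theorem differentiableOn_coord [IsManifold 𝓘(ℂ, ℂ) ω M] [ContMDiffVectorBundle ω F E 𝓘(ℂ, ℂ)]
    (s : HolomorphicSection F E) (x₀ : M) {φ : OpenPartialHomeomorph M ℂ}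
    (hφ : φ ∈ IsManifold.maximalAtlas 𝓘(ℂ, ℂ) ω M) :
    DifferentiableOn ℂ (fun z => (trivializationAt F E x₀ ⟨φ.symm z, s (φ.symm z)⟩).2)
      (φ.target ∩ φ.symm ⁻¹' (trivializationAt F E x₀).baseSet) := by
  intro z hz
  have h1 : ContMDiffAt 𝓘(ℂ, ℂ) 𝓘(ℂ, F) ω (fun x => (trivializationAt F E x₀ ⟨x, s x⟩).2)
      (φ.symm z) :=
    ((trivializationAt F E x₀).contMDiffAt_section_iff hz.2).1 (s.contMDiff _)
  have h2 := h1.comp z (contMDiffAt_symm_of_mem_maximalAtlas hφ hz.1)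
  exact (h2.contDiffAt.differentiableAt (by simp)).differentiableWithinAt

variable [MeasurableSpace M] [BorelSpace M]

/-- Integrals over `M \ supp D` dominate integrals in a local coordinate. -/
theorem lintegral_chart_le_lintegral_measureOff {ρ : TwoForm M} {S : Set M} (hS : IsClosed S)
    (hρ : IsVolumeFormOff ρ S) {φ : OpenPartialHomeomorph M ℂ}
    (hφ : φ ∈ IsManifold.maximalAtlas 𝓘(ℂ, ℂ) ω M) {f : M → ENNReal} (hf : Measurable f) :
    ∫⁻ z in φ.target \ φ.symm ⁻¹' S, ENNReal.ofReal (ρ.coeff φ z) * f (φ.symm z) ≤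
      ∫⁻ x, f x ∂(ρ.measureOff S) := by
  have hopen : IsOpen (φ.target \ φ.symm ⁻¹' S) :=
    φ.isOpen_inter_preimage_symm hS.isOpen_compl
  have hsymm : AEMeasurable φ.symm (volume.restrict (φ.target \ φ.symm ⁻¹' S)) :=
    (φ.symm.continuousOn.mono sdiff_subset).aemeasurable hopen.measurableSet
  have hd : AEMeasurable (fun z => ENNReal.ofReal (ρ.coeff φ z))
      (volume.restrict (φ.target \ φ.symm ⁻¹' S)) :=
    ((hρ.continuousOn φ hφ).aemeasurable hopen.measurableSet).ennreal_ofReal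
  -- A supremum of measures dominates each of them, so no compatibility between charts is needed.
  refine le_trans (le_of_eq ?_) (lintegral_mono' (le_iSup₂ (f := fun φ
    (_ : φ ∈ IsManifold.maximalAtlas 𝓘(ℂ, ℂ) ω M) =>
    (((volume : Measure ℂ).restrict (φ.target \ φ.symm ⁻¹' S)).withDensity
      fun z => ENNReal.ofReal (ρ.coeff φ z)).map φ.symm) φ hφ) le_rfl)
  rw [lintegral_map' hf.aemeasurable (hsymm.mono_ac (withDensity_absolutelyContinuous _ _))]
  exact (lintegral_withDensity_eq_lintegral_mul₀ hd (hf.comp_aemeasurable hsymm)).symm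

variable [T2Space M] [FiniteDimensional ℂ F] [IsManifold 𝓘(ℂ, ℂ) ω M] [ContMDiffVectorBundle ω F E 𝓘(ℂ, ℂ)]

/-- Near every point, the coordinates of holomorphic sections are uniformly bounded by the
`L²` norm. -/
theorem exists_coord_bound (h : HermitianMetric F E) (D : Divisor M) {ρ : TwoForm M}
    (hρ : IsVolumeFormOff ρ D.support) (x₀ : M) :
    ∃ r : ℝ, 0 < r ∧ closedBall (chartAt ℂ x₀ x₀) r ⊆ (chartAt ℂ x₀).target ∩
        (chartAt ℂ x₀).symm ⁻¹' (trivializationAt F E x₀).baseSet ∧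
      ∃ C : ENNReal, C ≠ ⊤ ∧ ∀ s : HolomorphicSection F E,
        ∀ z ∈ closedBall (chartAt ℂ x₀ x₀) r,
        ‖(trivializationAt F E x₀
          ⟨(chartAt ℂ x₀).symm z, s ((chartAt ℂ x₀).symm z)⟩).2‖ₑ ^ 2 ≤
        C * ∫⁻ x, ENNReal.ofReal (h.inner (s x) (s x)).re ∂(ρ.measureOff D.support) := by
  have : CompleteSpace F := FiniteDimensional.complete ℂ F
  set φ := chartAt ℂ x₀ with hφdef
  set e := trivializationAt F E x₀ with he
  have hφ : φ ∈ IsManifold.maximalAtlas 𝓘(ℂ, ℂ) ω M := IsManifold.chart_mem_maximalAtlas x₀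
  have hx₀ : x₀ ∈ φ.source := mem_chart_source ℂ x₀
  have hS : IsClosed D.support := D.closedSupport isClosed_univ
  set S := D.support
  -- a punctured neighbourhood without points of the divisor
  have hpunct : ∀ᶠ x in 𝓝 x₀, x ∈ S → x = x₀ := by
    obtain ⟨t, ht, hfin⟩ := D.supportLocallyFiniteWithinDomain x₀ (mem_univ x₀)
    -- Finite sets are closed in a Hausdorff space, so the remaining points of the divisor can be
    -- avoided.
    have hcl : IsClosed ((t ∩ S) \ {x₀}) := (hfin.sdiff).isClosed
    filter_upwards [ht, hcl.isOpen_compl.mem_nhds (by simp)] with x hx hx' hxS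
    by_contra hne
    exact hx' ⟨⟨hx, hxS⟩, hne⟩
  have hsymm : Filter.Tendsto φ.symm (𝓝 (φ x₀)) (𝓝 x₀) := by
    have := φ.continuousAt_symm (φ.map_source hx₀)
    rwa [ContinuousAt, φ.left_inv hx₀] at this
  have hev : ∀ᶠ z in 𝓝 (φ x₀), z ∈ φ.target ∧ φ.symm z ∈ e.baseSet ∧
      (φ.symm z ∈ S → φ.symm z = x₀) :=
    (φ.open_target.eventually_mem (φ.map_source hx₀)).and
      ((hsymm.eventually (e.open_baseSet.eventually_mem
        (FiberBundle.mem_baseSet_trivializationAt' x₀))).and (hsymm.eventually hpunct))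
  obtain ⟨R, hR, hball⟩ := nhds_basis_closedBall.eventually_iff.1 hev
  have hsub : closedBall (φ x₀) R ⊆ φ.target ∩ φ.symm ⁻¹' e.baseSet :=
    fun z hz => ⟨(hball hz).1, (hball hz).2.1⟩
  set A := closedBall (φ x₀) R \ ball (φ x₀) (R / 2) with hA
  have hAc : IsCompact A := (isCompact_closedBall _ _).diff isOpen_ball
  -- The centre is the only point of the ball that can lie on the divisor, and the annulus omits it.
  have hAsub : A ⊆ φ.target \ φ.symm ⁻¹' S := by
    rintro z ⟨hz, hz'⟩
    refine ⟨(hball hz).1, fun hzS => hz' ?_⟩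
    have h1 : φ.symm z = x₀ := (hball hz).2.2 hzS
    have h2 : z = φ x₀ := by rw [← h1, φ.right_inv (hball hz).1]
    rw [h2]
    exact mem_ball_self (by linarith)
  obtain ⟨ε, hε, hεle⟩ := h.exists_mul_norm_sq_le x₀ (K := φ.symm '' A)
    (hAc.image_of_continuousOn (φ.symm.continuousOn.mono (hAsub.trans sdiff_subset)))
    (by rintro _ ⟨z, hz, rfl⟩; exact (hsub hz.1).2)
  obtain ⟨δ, hδ, hδle⟩ := hAc.exists_forall_le' ((hρ.continuousOn φ hφ).mono hAsub)
    (a := 0) fun z hz => hρ.pos φ hφ z (hAsub hz)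
  obtain ⟨C, hC, hCle⟩ := exists_enorm_sq_le_lintegral_annulus F (φ x₀) hR
  have hmeasA : MeasurableSet A := measurableSet_closedBall.diff measurableSet_ball
  -- Here ε bounds h below and δ bounds the density of ρ below on the annulus, whence the factor 1 /
  -- (δε); the radius R / 4 comes from the annulus estimate.
  refine ⟨R / 4, by positivity, (closedBall_subset_closedBall (by linarith)).trans hsub,
    C * (ENNReal.ofReal (δ * ε))⁻¹, ENNReal.mul_ne_top hC (by simp [hδ, hε]), fun s z hz => ?_⟩
  set g : ℂ → F := fun z => (e ⟨φ.symm z, s (φ.symm z)⟩).2 with hg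
  have hgd : DifferentiableOn ℂ g (closedBall (φ x₀) R) :=
    (differentiableOn_coord s x₀ hφ).mono hsub
  refine (hCle g hgd z (by simpa [dist_eq_norm] using hz)).trans ?_
  rw [mul_assoc]
  gcongr
  have hfm : Measurable fun x => ENNReal.ofReal (h.inner (s x) (s x)).re :=
    (Complex.continuous_re.comp (h.continuous_inner s s)).measurable.ennreal_ofReal
  rw [← ENNReal.div_eq_inv_mul, ENNReal.le_div_iff_mul_le (by simp [hδ, hε]) (by simp),
    mul_comm, ← lintegral_const_mul' _ _ ENNReal.ofReal_ne_top]
  refine le_trans ?_ (lintegral_chart_le_lintegral_measureOff hS hρ hφ hfm)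
  refine le_trans ?_ (lintegral_mono_set hAsub)
  refine setLIntegral_mono' hmeasA fun w hw => ?_
  have h1 := hδle w hw
  have h2 := hεle _ (mem_image_of_mem _ hw) (s (φ.symm w))
  rw [← ofReal_norm, ← ENNReal.ofReal_pow (norm_nonneg _), ← ENNReal.ofReal_mul (by positivity),
    ← ENNReal.ofReal_mul (by linarith)]
  refine ENNReal.ofReal_le_ofReal ?_
  rw [mul_assoc]
  exact mul_le_mul h1 h2 (by positivity) (by linarith)

end LocalEstimate

/-! ### Convergence of L²-Cauchy sequences of sections -/

section Completeness

open Metric Set Filter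

variable {M : Type*} [TopologicalSpace M]
  {F : Type*} [NormedAddCommGroup F] [NormedSpace ℂ F]
  {E : M → Type*} [TopologicalSpace (TotalSpace F E)] [∀ x, AddCommGroup (E x)]
  [∀ x, Module ℂ (E x)] [∀ x, TopologicalSpace (E x)] [FiberBundle F E] [VectorBundle ℂ F E]

/-- Convergence in a fibre is convergence of the coordinates in a local trivialization. -/
theorem tendsto_fiber_iff {ι : Type*} {l : Filter ι} {x₀ x : M}
    (hx : x ∈ (trivializationAt F E x₀).baseSet) {v : ι → E x} {w : E x} :
    Tendsto v l (𝓝 w) ↔ Tendsto (fun i => (trivializationAt F E x₀ ⟨x, v i⟩).2) l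
      (𝓝 (trivializationAt F E x₀ ⟨x, w⟩).2) :=
  ((trivializationAt F E x₀).continuousLinearEquivAt ℂ x
    hx).toHomeomorph.isInducing.tendsto_nhds_iff

theorem trivializationAt_sub {x₀ x : M} (hx : x ∈ (trivializationAt F E x₀).baseSet)
    (v w : E x) : (trivializationAt F E x₀ ⟨x, v - w⟩).2 =
      (trivializationAt F E x₀ ⟨x, v⟩).2 - (trivializationAt F E x₀ ⟨x, w⟩).2 :=
  map_sub ((trivializationAt F E x₀).continuousLinearEquivAt ℂ x hx) v w

variable [ChartedSpace ℂ M] [MeasurableSpace M]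

/-- The square of the `L²` norm of a section, as an extended nonnegative real number. -/
noncomputable def l2NormSq (D : Divisor M) (ρ : TwoForm M) (h : HermitianMetric F E)
    (s : HolomorphicSection F E) : ENNReal :=
  ∫⁻ x, ENNReal.ofReal (h.inner (s x) (s x)).re ∂(ρ.measureOff D.support)

variable [BorelSpace M] [FiniteDimensional ℂ F]

theorem HermitianMetric.measurable_inner_self (h : HermitianMetric F E)
    (s : HolomorphicSection F E) :
    Measurable fun x => ENNReal.ofReal (h.inner (s x) (s x)).re :=
  (Complex.continuous_re.comp (h.continuous_inner s s)).measurable.ennreal_ofReal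

/-- Fatou's lemma for the `L²` norm of a pointwise limit of sections. -/
theorem l2NormSq_sub_le_liminf (D : Divisor M) (ρ : TwoForm M) (h : HermitianMetric F E)
    {u : ℕ → HolomorphicSection F E} {s : HolomorphicSection F E}
    (hs : ∀ x, Tendsto (fun n => u n x) atTop (𝓝 (s x))) (t : HolomorphicSection F E) :
    l2NormSq D ρ h (s - t) ≤ liminf (fun m => l2NormSq D ρ h (u m - t)) atTop := by
  refine le_trans (le_of_eq ?_) (lintegral_liminf_le fun m => h.measurable_inner_self (u m - t))
  refine lintegral_congr fun x => (Tendsto.liminf_eq ?_).symm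
  have hx : x ∈ (trivializationAt F E x).baseSet := FiberBundle.mem_baseSet_trivializationAt' x
  have hsub : Tendsto (fun m => (u m - t) x) atTop (𝓝 ((s - t) x)) := by
    rw [tendsto_fiber_iff hx]
    simp only [ContMDiffSection.coe_sub, Pi.sub_apply, trivializationAt_sub hx]
    exact ((tendsto_fiber_iff hx).1 (hs x)).sub_const _
  exact (ENNReal.continuous_ofReal.comp (h.continuous_inner_self x)).continuousAt.tendsto.comp hsub

variable [T2Space M] [IsManifold 𝓘(ℂ, ℂ) ω M] [ContMDiffVectorBundle ω F E 𝓘(ℂ, ℂ)]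

/-- A section of vanishing `L²` norm vanishes. -/
theorem eq_zero_of_l2NormSq_eq_zero {h : HermitianMetric F E} {D : Divisor M} {ρ : TwoForm M}
    (hρ : IsVolumeFormOff ρ D.support) {s : HolomorphicSection F E}
    (hs : l2NormSq D ρ h s = 0) : s = 0 := by
  ext x₀
  -- The estimate holds at the centre x₀ itself, even on the divisor, so no density argument is
  -- needed.
  obtain ⟨r, hr, -, C, -, hC⟩ := exists_coord_bound h D hρ x₀
  have h1 := hC s _ (mem_closedBall_self hr.le)
  rw [show ∫⁻ x, ENNReal.ofReal (h.inner (s x) (s x)).re ∂(ρ.measureOff D.support) = 0 from hs,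
    mul_zero, (chartAt ℂ x₀).left_inv (mem_chart_source ℂ x₀)] at h1
  have hx : x₀ ∈ (trivializationAt F E x₀).baseSet := FiberBundle.mem_baseSet_trivializationAt' x₀
  have h2 : (trivializationAt F E x₀).continuousLinearEquivAt ℂ x₀ hx (s x₀) = 0 := by
    simpa using h1
  exact (map_eq_zero_iff _ (ContinuousLinearEquiv.injective _)).1 h2

/-- A sequence of sections that is Cauchy for the `L²` norm has locally uniformly Cauchy
coordinates. -/
theorem exists_uniformCauchySeqOn_coord {h : HermitianMetric F E} {D : Divisor M} {ρ : TwoForm M}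
    (hρ : IsVolumeFormOff ρ D.support) {u : ℕ → HolomorphicSection F E}
    (hu : Tendsto (fun p : ℕ × ℕ => l2NormSq D ρ h (u p.1 - u p.2)) (atTop ×ˢ atTop) (𝓝 0))
    (x₀ : M) :
    ∃ r : ℝ, 0 < r ∧ closedBall (chartAt ℂ x₀ x₀) r ⊆ (chartAt ℂ x₀).target ∩
        (chartAt ℂ x₀).symm ⁻¹' (trivializationAt F E x₀).baseSet ∧
      UniformCauchySeqOn (fun n z => (trivializationAt F E x₀
        ⟨(chartAt ℂ x₀).symm z, u n ((chartAt ℂ x₀).symm z)⟩).2) atTop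
        (closedBall (chartAt ℂ x₀ x₀) r) := by
  obtain ⟨r, hr, hsub, C, hC, hle⟩ := exists_coord_bound h D hρ x₀
  refine ⟨r, hr, hsub, fun V hV => ?_⟩
  obtain ⟨ε, hε, hεV⟩ := Metric.mem_uniformity_dist.1 hV
  have hlim := ENNReal.Tendsto.const_mul hu (Or.inr hC)
  rw [mul_zero] at hlim
  -- The threshold is ε² because the coordinate bound is for squares.
  filter_upwards [hlim.eventually_lt_const
    (show (0 : ENNReal) < ENNReal.ofReal ε ^ 2 from ENNReal.pow_pos (ENNReal.ofReal_pos.2 hε) 2)] with p hp z hz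
  refine hεV ?_
  have h1 := (hle (u p.1 - u p.2) z hz).trans_lt hp
  rw [show (trivializationAt F E x₀ ⟨(chartAt ℂ x₀).symm z,
    (u p.1 - u p.2) ((chartAt ℂ x₀).symm z)⟩).2 = _ from trivializationAt_sub (hsub hz).2 _ _] at h1
  have h2 := lt_of_not_ge fun hge => h1.not_ge (pow_le_pow_left' hge 2)
  rw [← ofReal_norm, ENNReal.ofReal_lt_ofReal_iff hε] at h2
  rwa [dist_eq_norm]

/-- A sequence of holomorphic sections that is Cauchy for the `L²` norm converges pointwise to a
holomorphic section. -/
theorem exists_tendsto_section {h : HermitianMetric F E} {D : Divisor M} {ρ : TwoForm M}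
    (hρ : IsVolumeFormOff ρ D.support) {u : ℕ → HolomorphicSection F E}
    (hu : Tendsto (fun p : ℕ × ℕ => l2NormSq D ρ h (u p.1 - u p.2)) (atTop ×ˢ atTop) (𝓝 0)) :
    ∃ s : HolomorphicSection F E, ∀ x, Tendsto (fun n => u n x) atTop (𝓝 (s x)) := by
  have : CompleteSpace F := FiniteDimensional.complete ℂ F
  have hpt : ∀ x, ∃ v : E x, Tendsto (fun n => u n x) atTop (𝓝 v) := by
    intro x
    obtain ⟨r, hr, -, hcau⟩ := exists_uniformCauchySeqOn_coord hρ hu x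
    have hx : x ∈ (trivializationAt F E x).baseSet := FiberBundle.mem_baseSet_trivializationAt' x
    obtain ⟨w, hw⟩ := cauchySeq_tendsto_of_complete (hcau.cauchySeq (mem_closedBall_self hr.le))
    rw [(chartAt ℂ x).left_inv (mem_chart_source ℂ x)] at hw
    refine ⟨(trivializationAt F E x).symm x w, (tendsto_fiber_iff hx).2 ?_⟩
    rwa [(trivializationAt F E x).apply_mk_symm hx]
  choose s hs using hpt
  refine ⟨⟨s, fun x₀ => ?_⟩, hs⟩
  rw [contMDiffAt_section]
  obtain ⟨r, hr, hsub, hcau⟩ := exists_uniformCauchySeqOn_coord hρ hu x₀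
  set φ := chartAt ℂ x₀ with hφdef
  set e := trivializationAt F E x₀ with he
  have hφ : φ ∈ IsManifold.maximalAtlas 𝓘(ℂ, ℂ) ω M := IsManifold.chart_mem_maximalAtlas x₀
  have hx₀ : x₀ ∈ φ.source := mem_chart_source ℂ x₀
  -- The limits were found in a different trivialization at each point; convergence in the fibre
  -- carries them over to the one at x₀.
  have hunif := hcau.tendstoUniformlyOn_of_tendsto
    (f := fun z => (e ⟨φ.symm z, s (φ.symm z)⟩).2)
    fun z hz => (tendsto_fiber_iff (hsub hz).2).1 (hs (φ.symm z))
  -- Weierstrass: a locally uniform limit of holomorphic functions is holomorphic.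
  have hdiff : DifferentiableOn ℂ (fun z => (e ⟨φ.symm z, s (φ.symm z)⟩).2) (ball (φ x₀) r) :=
    (hunif.mono ball_subset_closedBall).tendstoLocallyUniformlyOn.differentiableOn
      (Eventually.of_forall fun n => (differentiableOn_coord (u n) x₀ hφ).mono
        (ball_subset_closedBall.trans hsub)) isOpen_ball
  have hcd : ContDiffAt ℂ ω (fun z => (e ⟨φ.symm z, s (φ.symm z)⟩).2) (φ x₀) :=
    (hdiff.contDiffOn isOpen_ball).contDiffAt (isOpen_ball.mem_nhds (mem_ball_self hr))
  have hcm : ContMDiffAt 𝓘(ℂ, ℂ) 𝓘(ℂ, F) ω _ x₀ :=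
    hcd.contMDiffAt.comp x₀ (contMDiffAt_of_mem_maximalAtlas hφ hx₀)
  refine hcm.congr_of_eventuallyEq ?_
  filter_upwards [φ.open_source.mem_nhds hx₀] with x hx
  rw [Function.comp_apply, φ.left_inv hx]

/-- A sequence of holomorphic sections that is Cauchy for the `L²` norm converges to a holomorphic
section. -/
theorem exists_tendsto_l2NormSq {h : HermitianMetric F E} {D : Divisor M} {ρ : TwoForm M}
    (hρ : IsVolumeFormOff ρ D.support) {u : ℕ → HolomorphicSection F E}
    (hu : Tendsto (fun p : ℕ × ℕ => l2NormSq D ρ h (u p.1 - u p.2)) (atTop ×ˢ atTop) (𝓝 0)) :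
    ∃ s : HolomorphicSection F E,
      Tendsto (fun n => l2NormSq D ρ h (s - u n)) atTop (𝓝 0) := by
  obtain ⟨s, hs⟩ := exists_tendsto_section hρ hu
  refine ⟨s, ENNReal.tendsto_nhds_zero.2 fun ε hε => ?_⟩
  have hev := ENNReal.tendsto_nhds_zero.1 hu ε hε
  rw [prod_atTop_atTop_eq, eventually_atTop] at hev
  obtain ⟨⟨N₁, N₂⟩, hN⟩ := hev
  filter_upwards [eventually_ge_atTop N₂] with n hn
  -- Fatou with n fixed and m → ∞: the liminf is at most ε by the Cauchy condition.
  refine (l2NormSq_sub_le_liminf D ρ h hs (u n)).trans ?_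
  refine liminf_le_of_frequently_le' (Eventually.frequently ?_)
  filter_upwards [eventually_ge_atTop N₁] with m hm
  exact hN (m, n) ⟨hm, hn⟩

end Completeness

/-! ### The Hilbert space structure -/

section Hilbert

open Filter

/-- A criterion for completeness of the norm of an inner product, by convergence of squares of
norms. -/
theorem completeSpace_of_core {V : Type*} [AddCommGroup V] [Module ℂ V]
    (c : InnerProductSpace.Core ℂ V)
    (hc : ∀ u : ℕ → V, Tendsto (fun p : ℕ × ℕ =>
        RCLike.re (c.inner (u p.1 - u p.2) (u p.1 - u p.2))) (atTop ×ˢ atTop) (𝓝 0) →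
      ∃ v : V, Tendsto (fun n => RCLike.re (c.inner (v - u n) (v - u n))) atTop (𝓝 0)) :
    letI : NormedAddCommGroup V := c.toNormedAddCommGroup
    CompleteSpace V := by
  let _ : NormedAddCommGroup V := c.toNormedAddCommGroup
  have hnorm : ∀ v : V, ‖v‖ = √(RCLike.re (c.inner v v)) := fun v => rfl
  have hsq : ∀ v : V, RCLike.re (c.inner v v) = ‖v‖ ^ 2 := fun v => by
    rw [hnorm, Real.sq_sqrt (c.re_inner_nonneg v)]
  refine UniformSpace.complete_of_cauchySeq_tendsto fun u hu => ?_
  have hlim : Tendsto (fun p : ℕ × ℕ => ‖u p.1 - u p.2‖) (atTop ×ˢ atTop) (𝓝 0) := by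
    have := cauchySeq_iff_tendsto_dist_atTop_0.1 hu
    simpa only [dist_eq_norm, prod_atTop_atTop_eq] using this
  obtain ⟨v, hv⟩ := hc u (by simpa only [hsq, zero_pow two_ne_zero] using hlim.pow 2)
  refine ⟨v, tendsto_iff_norm_sub_tendsto_zero.2 ?_⟩
  have hsqrt := (Real.continuous_sqrt.tendsto 0).comp hv
  rw [Real.sqrt_zero] at hsqrt
  exact hsqrt.congr fun n => by rw [norm_sub_rev, hnorm, Function.comp_apply]

variable {M : Type*} [TopologicalSpace M] [ChartedSpace ℂ M] [MeasurableSpace M] [BorelSpace M]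
  {F : Type*} [NormedAddCommGroup F] [NormedSpace ℂ F] [FiniteDimensional ℂ F]
  {E : M → Type*} [TopologicalSpace (TotalSpace F E)] [∀ x, AddCommGroup (E x)]
  [∀ x, Module ℂ (E x)] [∀ x, TopologicalSpace (E x)] [FiberBundle F E] [VectorBundle ℂ F E]
  {h : HermitianMetric F E} {D : Divisor M} {ρ : TwoForm M}

theorem integrable_inner_self (s : bergmanSpace D ρ h) :
    Integrable (fun x => (h.inner (s.1 x) (s.1 x)).re) (ρ.measureOff D.support) := by
  refine ⟨(Complex.continuous_re.comp (h.continuous_inner s.1 s.1)).measurable.aestronglyMeasurable,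
    ?_⟩
  rw [hasFiniteIntegral_iff_ofReal (Eventually.of_forall fun x => h.inner_self_nonneg _)]
  exact s.2

/-- The `L²` scalar product of two sections in the Bergman space converges absolutely. -/
theorem integrable_inner (s t : bergmanSpace D ρ h) :
    Integrable (fun x => h.inner (s.1 x) (t.1 x)) (ρ.measureOff D.support) :=
  ((integrable_inner_self s).add (integrable_inner_self t)).mono'
    (h.continuous_inner s.1 t.1).measurable.aestronglyMeasurable
    (Eventually.of_forall fun _ => h.norm_inner_le _ _)

theorem re_l2Inner_self (s : bergmanSpace D ρ h) :
    (l2Inner D ρ h s.1 s.1).re = ∫ x, (h.inner (s.1 x) (s.1 x)).re ∂(ρ.measureOff D.support) :=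
  (integral_re (integrable_inner s s)).symm

/-- This links the Bochner integral defining the scalar product to the extended nonnegative integral
used for the estimates and Fatou's lemma. -/
theorem ofReal_re_l2Inner_self (s : bergmanSpace D ρ h) :
    ENNReal.ofReal (l2Inner D ρ h s.1 s.1).re = l2NormSq D ρ h s.1 := by
  rw [re_l2Inner_self, ofReal_integral_eq_lintegral_ofReal (integrable_inner_self s)
    (Eventually.of_forall fun x => h.inner_self_nonneg _)]
  rfl

variable [T2Space M] [IsManifold 𝓘(ℂ, ℂ) ω M] [ContMDiffVectorBundle ω F E 𝓘(ℂ, ℂ)]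

/-- The `L²` scalar product is a positive definite inner product on the Bergman space. -/
@[reducible]
noncomputable def bergmanCore (h : HermitianMetric F E)
    (hρ : IsVolumeFormOff ρ D.support) : InnerProductSpace.Core ℂ (bergmanSpace D ρ h) where
  inner s t := l2Inner D ρ h s.1 t.1
  conj_inner_symm s t := by
    rw [l2Inner, ← integral_conj]
    exact integral_congr_ae (Eventually.of_forall fun x => (h.core x).conj_inner_symm _ _)
  re_inner_nonneg s := by
    change 0 ≤ (l2Inner D ρ h s.1 s.1).re
    rw [re_l2Inner_self]
    exact integral_nonneg fun x => h.inner_self_nonneg _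
  add_left s t v := by
    rw [l2Inner, l2Inner, l2Inner,
      ← integral_add (integrable_inner s v) (integrable_inner t v)]
    exact integral_congr_ae (Eventually.of_forall fun x => (h.core x).add_left _ _ _)
  smul_left s t c := by
    rw [l2Inner, l2Inner, ← integral_const_mul]
    exact integral_congr_ae (Eventually.of_forall fun x => (h.core x).smul_left _ _ _)
  definite s hs := by
    refine Subtype.ext (eq_zero_of_l2NormSq_eq_zero (h := h) hρ ?_)
    rw [← ofReal_re_l2Inner_self, show l2Inner D ρ h s.1 s.1 = 0 from hs]
    simp

/-- A sequence in the Bergman space that is Cauchy for the `L²` norm converges in the Bergman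
space. -/
theorem exists_tendsto_bergmanSpace (hρ : IsVolumeFormOff ρ D.support)
    {u : ℕ → bergmanSpace D ρ h}
    (hu : Tendsto (fun p : ℕ × ℕ => l2NormSq D ρ h (u p.1 - u p.2).1) (atTop ×ˢ atTop) (𝓝 0)) :
    ∃ s : bergmanSpace D ρ h, Tendsto (fun n => l2NormSq D ρ h (s - u n).1) atTop (𝓝 0) := by
  obtain ⟨s, hs⟩ := exists_tendsto_l2NormSq hρ (u := fun n => (u n).1) hu
  obtain ⟨N, hN⟩ := (hs.eventually_lt_const ENNReal.zero_lt_top).exists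
  -- A single difference of finite norm already places s in the space.
  have hsub : s - (u N).1 ∈ bergmanSpace D ρ h := hN
  exact ⟨⟨s, ((bergmanSpace D ρ h).sub_mem_iff_left (u N).2).1 hsub⟩, hs⟩

/-- The Bergman space is complete for the `L²` norm. -/
theorem completeSpace_bergmanCore (h : HermitianMetric F E) (hρ : IsVolumeFormOff ρ D.support) :
    letI : NormedAddCommGroup (bergmanSpace D ρ h) := (bergmanCore h hρ).toNormedAddCommGroup
    CompleteSpace (bergmanSpace D ρ h) := by
  have hsq : ∀ s : bergmanSpace D ρ h,
      RCLike.re ((bergmanCore h hρ).inner s s) = (l2NormSq D ρ h s.1).toReal := fun s => by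
    rw [← ofReal_re_l2Inner_self]
    exact (ENNReal.toReal_ofReal ((bergmanCore h hρ).re_inner_nonneg s)).symm
  refine completeSpace_of_core (bergmanCore h hρ) fun u hu => ?_
  simp only [hsq] at hu ⊢
  -- Finiteness is needed to lift convergence to 0 from the reals back to extended values.
  have hfin : ∀ s : bergmanSpace D ρ h, l2NormSq D ρ h s.1 ≠ ⊤ := fun s => s.2.ne
  obtain ⟨s, hs⟩ := exists_tendsto_bergmanSpace hρ (u := u)
    ((ENNReal.tendsto_toReal_iff (fun p => hfin _) ENNReal.zero_ne_top).1 hu)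
  exact ⟨s, (ENNReal.tendsto_toReal ENNReal.zero_ne_top).comp hs⟩

end Hilbert

end Bergman

/-- The Bergman space of a continuous Hermitian holomorphic vector bundle with respect to a
`D`-volume form is a Hilbert space: the `L²` scalar product is a well-defined, positive definite
inner product on it, and it is complete for the associated norm. -/
theorem mainTheorem9
    {M : Type*} [TopologicalSpace M] [T2Space M] [ChartedSpace ℂ M] [IsManifold 𝓘(ℂ, ℂ) ω M]
    [MeasurableSpace M] [BorelSpace M]
    {F : Type*} [NormedAddCommGroup F] [NormedSpace ℂ F] [FiniteDimensional ℂ F]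
    {E : M → Type*} [TopologicalSpace (TotalSpace F E)] [∀ x, AddCommGroup (E x)]
    [∀ x, Module ℂ (E x)] [∀ x, TopologicalSpace (E x)] [FiberBundle F E] [VectorBundle ℂ F E]
    [ContMDiffVectorBundle ω F E 𝓘(ℂ, ℂ)]
    (h : Bergman.HermitianMetric F E) (D : Bergman.Divisor M) (ρ : Bergman.TwoForm M)
    (hρ : Bergman.IsDivisorVolumeForm D ρ) :
    (∀ s t : Bergman.bergmanSpace D ρ h,
      Integrable (fun x => h.inner (s.1 x) (t.1 x)) (ρ.measureOff D.support)) ∧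
    ∃ c : InnerProductSpace.Core ℂ (Bergman.bergmanSpace D ρ h),
      (∀ s t : Bergman.bergmanSpace D ρ h, c.inner s t = Bergman.l2Inner D ρ h s.1 t.1) ∧
      (letI : NormedAddCommGroup (Bergman.bergmanSpace D ρ h) := c.toNormedAddCommGroup
       CompleteSpace (Bergman.bergmanSpace D ρ h)) := by
  exact ⟨Bergman.integrable_inner, Bergman.bergmanCore h hρ.toIsVolumeFormOff,
    fun _ _ => rfl, Bergman.completeSpace_bergmanCore h hρ.toIsVolumeFormOff⟩
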